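/- Let $\mathcal C$ be a regular category (finitely complete, with pullback-stable regular epimorphisms, in which every kernel pair has a coequalizer) that is * quasi-pointed: it has an initial object $0$ and a terminal object $1$, and $0\to 1$ is a monomorphism; * Mal'tsev: every internal reflexive relation is an equivalence relation; * such that pushouts of split monomorphisms along arbitrary morphisms exist. Let $\mathsf{EqRel}(\mathcal C)$ be the category of internal equivalence relations $(R,r_1,r_2)$ on objects $X$ of $\mathcal C$; a morphism $(R,r_1,r_2,X)\to(S,s_1,s_2,Y)$ is a morphism $f\colon X\to Y$ such that $f\times f$ restricts to $R\to S$. A morphism $n\colon N\to X$ is *Bourn-normal* to an equivalence relation $(R,r_1,r_2)$ on $X$ if $n\times n$ factors as $\langle r_1,r_2\rangle\cdot\tilde n$ for some $\tilde n\colon N\times N\to R$ such that both the square $\langle r_1,r_2\rangle\cdot\tilde n=(n\times n)\cdot 1_{N\times N}$ and the square $r_1\cdot\tilde n=n\cdot p_1$ are pullbacks; it is *Bourn-normal* if it is Bourn-normal to some equivalence relation on $X$ (it is then a monomorphism). Let $\mathsf N(\mathcal C)$ be the full subcategory of the arrow category $\mathsf{Arr}(\mathcal C)$ on the Bourn-normal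 monomorphisms, and $\mathsf N_0(\mathcal C)\subseteq\mathsf N(\mathcal C)$ the full subcategory of those $n\colon N\to X$ whose domain has null support, i.e. admits an arrow $N\to 0$. Let $\mathrm{Nor}\colon\mathsf{EqRel}(\mathcal C)\to\mathsf N(\mathcal C)$ be the normalization functor, $\mathrm{Nor}(R,r_1,r_2)=r_2\cdot k$, where $k=\ker(r_1)$ is the pullback of $0\to X$ along $r_1$. Let $\mathrm{Rel}\colon\mathsf N(\mathcal C)\to\mathsf{EqRel}(\mathcal C)$ be the functor sending $n\colon N\to X$ to the image in $X\times X$ (by the regular epi–mono factorization) of the map $\langle d,c\rangle\colon (N\times N)\sqcup_N X\to X\times X$, where the pushout is taken along the diagonal $N\to N\times N$ and $n$, and $d$ and $c$ are induced by $(n\cdot p_1,1_X)$ and $(n\cdot p_2,1_X)$ respectively. Then: 1. $\mathsf N_0(\mathcal C)$ is the essential image of $\mathrm{Nor}$, and the restrictions of $\mathrm{Rel}$ and $\mathrm{Nor}$ form a monomorphic coreflection $$\mathrm{Rel}\dashv\mathrm{Nor}\colon\ \mathsf N_0(\mathcal C)\rightleftarrows\mathsf{EqRel}(\mathcal C),$$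 that is, an adjunction with $\mathrm{Rel}$ fully faithful on $\mathsf N_0(\mathcal C)$ (equivalently, with invertible unit), and with counit components $\mathrm{Rel}(\mathrm{Nor}(S))\to S$ that are monomorphisms, both in $\mathsf{EqRel}(\mathcal C)$ and on the underlying objects of the relations. The unit and the counit are the identity on the object $X$ on which the arrows and the relations live. 2. The adjunction restricts to an adjoint equivalence between $\mathsf N_0(\mathcal C)$ and the essential image $\mathrm{Rel}(\mathsf N_0(\mathcal C))$, a full subcategory of $\mathsf{EqRel}(\mathcal C)$: the functors are the restrictions of $\mathrm{Rel}$ and $\mathrm{Nor}$, the unit and the counit are the restrictions of those in (1), and both are isomorphisms. -/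

import Mathlib

open CategoryTheory CategoryTheory.Limits

universe v u

noncomputable section

namespace BournNormal

variable (C : Type u) [Category.{v} C]

/-- A quasi-pointed category: there are an initial object `0` and a terminal object `1`, and the
unique arrow `0 ⟶ 1` is a monomorphism. -/
class QuasiPointed : Prop extends HasInitial C, HasTerminal C where
  mono_initial_to_terminal : Mono (initial.to (⊤_ C))

/-- A finitely complete category is a Mal'tsev category when every (internal) reflexive relation
is an equivalence relation. -/
class Maltsev [HasFiniteLimits C] : Prop where
  isEquivalenceRelation_of_reflexive {R X : C} (r₁ r₂ : R ⟶ X) :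
    ReflexiveRelation r₁ r₂ → IsEquivalenceRelation r₁ r₂

/-- Pushouts of split monomorphisms along arbitrary morphisms exist. -/
class HasPushoutsOfSplitMono : Prop where
  hasPushout {A B D : C} (s : A ⟶ B) (f : A ⟶ D) : IsSplitMono s → HasPushout s f

/-! ### The category of internal equivalence relations -/

/-- An internal equivalence relation `r₁, r₂ : rel ⇉ base`. -/
structure EqRel where
  base : C
  rel : C
  r₁ : rel ⟶ base
  r₂ : rel ⟶ base
  isEquivalenceRelation : IsEquivalenceRelation r₁ r₂

variable {C}

namespace EqRel

/-- A morphism of equivalence relations is a morphism `f` of the base objects such that `f × f`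
restricts to the relations. The restriction is unique, because `r₁, r₂` are jointly monic
(see `EqRel.hom_ext`). -/
structure Hom (R S : EqRel C) where
  base : R.base ⟶ S.base
  rel : R.rel ⟶ S.rel
  comm₁ : rel ≫ S.r₁ = R.r₁ ≫ base
  comm₂ : rel ≫ S.r₂ = R.r₂ ≫ base

lemma rel_ext (R : EqRel C) {T : C} {a b : T ⟶ R.rel} (h₁ : a ≫ R.r₁ = b ≫ R.r₁)
    (h₂ : a ≫ R.r₂ = b ≫ R.r₂) : a = b := by
  obtain ⟨e⟩ := R.isEquivalenceRelation.nonempty_equivalenceRelation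
  exact e.right_cancellation a b h₁ h₂

lemma Hom.ext_base {R S : EqRel C} {f g : Hom R S} (h : f.base = g.base) : f = g := by
  have h' : f.rel = g.rel := S.rel_ext (by rw [f.comm₁, g.comm₁, h]) (by rw [f.comm₂, g.comm₂, h])
  cases f
  cases g
  subst h h'
  rfl

instance : Category.{v} (EqRel C) where
  Hom := Hom
  id R := ⟨𝟙 _, 𝟙 _, by simp, by simp⟩
  comp f g := ⟨f.base ≫ g.base, f.rel ≫ g.rel,
    by rw [Category.assoc, g.comm₁, ← Category.assoc, f.comm₁, Category.assoc],
    by rw [Category.assoc, g.comm₂, ← Category.assoc, f.comm₂, Category.assoc]⟩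
  id_comp _ := Hom.ext_base (Category.id_comp _)
  comp_id _ := Hom.ext_base (Category.comp_id _)
  assoc _ _ _ := Hom.ext_base (Category.assoc _ _ _)

lemma hom_ext {R S : EqRel C} {f g : R ⟶ S} (h : f.base = g.base) : f = g := Hom.ext_base h

@[simp] lemma id_base (R : EqRel C) : Hom.base (𝟙 R) = 𝟙 R.base := rfl

@[simp] lemma id_rel (R : EqRel C) : Hom.rel (𝟙 R) = 𝟙 R.rel := rfl

@[simp] lemma comp_base {R S T : EqRel C} (f : R ⟶ S) (g : S ⟶ T) :
    Hom.base (f ≫ g) = f.base ≫ g.base := rfl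

@[simp] lemma comp_rel {R S T : EqRel C} (f : R ⟶ S) (g : S ⟶ T) :
    Hom.rel (f ≫ g) = f.rel ≫ g.rel := rfl

lemma exists_symm (R : EqRel C) {T : C} (h : T ⟶ R.rel) :
    ∃ h' : T ⟶ R.rel, h' ≫ R.r₁ = h ≫ R.r₂ ∧ h' ≫ R.r₂ = h ≫ R.r₁ := by
  obtain ⟨e⟩ := R.isEquivalenceRelation.nonempty_equivalenceRelation
  exact ⟨h ≫ e.s, by rw [Category.assoc, e.symmetry₁], by rw [Category.assoc, e.symmetry₂]⟩

lemma exists_trans (R : EqRel C) {T : C} (h h' : T ⟶ R.rel) (w : h ≫ R.r₂ = h' ≫ R.r₁) :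
    ∃ l : T ⟶ R.rel, l ≫ R.r₁ = h ≫ R.r₁ ∧ l ≫ R.r₂ = h' ≫ R.r₂ := by
  obtain ⟨e⟩ := R.isEquivalenceRelation.nonempty_equivalenceRelation
  have hf := PullbackCone.IsLimit.lift_fst e.isLimit h h' w
  have hs := PullbackCone.IsLimit.lift_snd e.isLimit h h' w
  refine ⟨PullbackCone.IsLimit.lift e.isLimit h h' w ≫ e.t, ?_, ?_⟩
  · rw [Category.assoc, e.transitivity₁, ← Category.assoc, hf]
  · rw [Category.assoc, e.transitivity₂, ← Category.assoc, hs]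

end EqRel

/-! ### Bourn-normal monomorphisms -/

section Normal

variable [HasFiniteLimits C]

/-- `n : N ⟶ X` is Bourn-normal to the relation `r₁, r₂ : R ⇉ X`: `n × n` factors through
`⟨r₁, r₂⟩` as some `t`, and both of the following squares are pullbacks.
```
  N × N --t--> R              N × N --t--> R
    ‖          | ⟨r₁,r₂⟩      p₁|          | r₁
  N × N -n×n-> X × X            N ---n---> X
``` -/
def IsBournNormalTo {N X R : C} (n : N ⟶ X) (r₁ r₂ : R ⟶ X) : Prop :=
  ∃ t : N ⨯ N ⟶ R,
    IsPullback t (𝟙 (N ⨯ N)) (prod.lift r₁ r₂) (prod.map n n) ∧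
    IsPullback t (prod.fst : N ⨯ N ⟶ N) r₁ n

/-- `n` is Bourn-normal when it is Bourn-normal to some equivalence relation on its codomain.
(Such an `n` is automatically a monomorphism.) -/
def IsBournNormal {N X : C} (n : N ⟶ X) : Prop :=
  ∃ (R : C) (r₁ r₂ : R ⟶ X), IsEquivalenceRelation r₁ r₂ ∧ IsBournNormalTo n r₁ r₂

variable (C) in
/-- The category `N(C)` of Bourn-normal monomorphisms, a full subcategory of the category of
arrows of `C`. -/
abbrev NormalMono := ObjectProperty.FullSubcategory
  (fun n : Arrow C => IsBournNormal n.hom)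

end Normal

/-- `A` has null support when there is an arrow from `A` to the initial object. -/
def HasNullSupport [HasInitial C] (A : C) : Prop := Nonempty (A ⟶ ⊥_ C)

variable (C) in
/-- The full subcategory `N₀(C)` of `N(C)` given by the Bourn-normal monomorphisms whose domain
has null support. -/
abbrev NormalMono₀ [HasFiniteLimits C] [HasInitial C] := ObjectProperty.FullSubcategory
  (fun n : NormalMono C => HasNullSupport n.obj.left)

/-! ### The normalization functor -/

lemma eq_of_to_initial [QuasiPointed C] {T : C} (a b : T ⟶ ⊥_ C) : a = b := by
  have := QuasiPointed.mono_initial_to_terminal (C := C)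
  rw [← cancel_mono (initial.to (⊤_ C))]
  exact terminalIsTerminal.hom_ext _ _

section Nor

variable [HasFiniteLimits C]

section

variable [HasInitial C]

/-- The kernel object of `f : A ⟶ B`: the pullback of `f` along the initial arrow `0 ⟶ B`. -/
abbrev ker {A B : C} (f : A ⟶ B) : C := pullback (initial.to B) f

/-- The kernel of `f : A ⟶ B`. -/
abbrev kerι {A B : C} (f : A ⟶ B) : ker f ⟶ A := pullback.snd (initial.to B) f

/-- The normalization `r₂ ∘ ker(r₁)` of an equivalence relation. -/
def normalization (R : EqRel C) : ker R.r₁ ⟶ R.base := kerι R.r₁ ≫ R.r₂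

/-- The map induced by a morphism of equivalence relations on the domains of the
normalizations. -/
def kerMap {R S : EqRel C} (f : R ⟶ S) : ker R.r₁ ⟶ ker S.r₁ :=
  pullback.lift (pullback.fst _ _) (kerι R.r₁ ≫ f.rel) (by
    rw [Category.assoc, f.comm₁, ← pullback.condition_assoc]
    congr 1
    exact initialIsInitial.hom_ext _ _)

lemma kerMap_fst {R S : EqRel C} (f : R ⟶ S) :
    kerMap f ≫ pullback.fst (initial.to S.base) S.r₁ = pullback.fst _ _ :=
  pullback.lift_fst _ _ _

lemma kerMap_kerι {R S : EqRel C} (f : R ⟶ S) :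
    kerMap f ≫ kerι S.r₁ = kerι R.r₁ ≫ f.rel :=
  pullback.lift_snd _ _ _

/-- Normalization as a functor from equivalence relations to arrows. -/
def norArrow : EqRel C ⥤ Arrow C where
  obj R := Arrow.mk (normalization R)
  map {R S} f := Arrow.homMk (kerMap f) f.base (by
    simp only [Arrow.mk_hom, normalization]
    rw [← Category.assoc, kerMap_kerι, Category.assoc, f.comm₂, Category.assoc])
  map_id R := by
    ext
    · apply pullback.hom_ext
      · simp [kerMap_fst]
      · simp [kerMap_kerι]
    · simp
  map_comp {R S T} f g := by
    ext
    · apply pullback.hom_ext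
      · simp [kerMap_fst]
      · simp [kerMap_kerι]
        rw [← Category.assoc, ← Category.assoc, kerMap_kerι, Category.assoc]
    · simp

end

variable [QuasiPointed C]

lemma normalization_cancel (R : EqRel C) {T : C} {a b : T ⟶ ker R.r₁}
    (h : a ≫ normalization R = b ≫ normalization R) : a = b := by
  have h0 : a ≫ pullback.fst _ _ = b ≫ pullback.fst _ _ := eq_of_to_initial _ _
  apply pullback.hom_ext h0
  apply R.rel_ext
  · rw [Category.assoc, Category.assoc, ← pullback.condition, ← Category.assoc, h0, Category.assoc]
  · simpa [normalization] using h

lemma isBournNormalTo_normalization (R : EqRel C) :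
    IsBournNormalTo (normalization R) R.r₁ R.r₂ := by
  have hk : kerι R.r₁ ≫ R.r₁ = pullback.fst _ _ ≫ initial.to R.base := pullback.condition.symm
  obtain ⟨σ, hσ₁, hσ₂⟩ := R.exists_symm
    ((prod.fst : ker R.r₁ ⨯ ker R.r₁ ⟶ ker R.r₁) ≫ kerι R.r₁)
  obtain ⟨t, ht₁, ht₂⟩ := R.exists_trans σ
    ((prod.snd : ker R.r₁ ⨯ ker R.r₁ ⟶ ker R.r₁) ≫ kerι R.r₁) (by
      rw [hσ₂, Category.assoc, Category.assoc, hk, ← Category.assoc, ← Category.assoc]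
      congr 1
      exact eq_of_to_initial _ _)
  have h₁ : t ≫ R.r₁ = prod.fst ≫ normalization R := by
    rw [ht₁, hσ₁, Category.assoc]; rfl
  have h₂ : t ≫ R.r₂ = prod.snd ≫ normalization R := by
    rw [ht₂, Category.assoc]; rfl
  refine ⟨t, ?_, ?_⟩
  · refine ⟨⟨?_⟩, ⟨PullbackCone.IsLimit.mk _ (fun s => s.snd) ?_ ?_ ?_⟩⟩
    · apply Limits.prod.hom_ext <;> simp [h₁, h₂]
    · intro s
      have hs := s.condition
      have e₁ := congrArg (fun x => x ≫ prod.fst) hs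
      have e₂ := congrArg (fun x => x ≫ prod.snd) hs
      simp only [Category.assoc, prod.lift_fst, prod.lift_snd, prod.map_fst, prod.map_snd] at e₁ e₂
      apply R.rel_ext
      · rw [Category.assoc, h₁, e₁]
      · rw [Category.assoc, h₂, e₂]
    · intro s
      simp
    · intro s m _ hm
      simpa using hm
  · have key : ∀ {T : C} (s : T ⟶ R.rel) (a : T ⟶ ker R.r₁), s ≫ R.r₁ = a ≫ normalization R →
        ∃ b : T ⟶ ker R.r₁, b ≫ normalization R = s ≫ R.r₂ := by
      intro T s a hsa
      obtain ⟨l, hl₁, hl₂⟩ := R.exists_trans (a ≫ kerι R.r₁) s (by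
        rw [hsa, Category.assoc]; rfl)
      refine ⟨pullback.lift (a ≫ pullback.fst _ _) l ?_, ?_⟩
      · rw [hl₁, Category.assoc, Category.assoc, hk]
      · rw [normalization, ← Category.assoc, pullback.lift_snd, hl₂]
    refine ⟨⟨h₁⟩, ⟨PullbackCone.IsLimit.mk _
      (fun s => prod.lift s.snd (key s.fst s.snd s.condition).choose) ?_ ?_ ?_⟩⟩
    · intro s
      have hc := (key s.fst s.snd s.condition).choose_spec
      apply R.rel_ext
      · rw [Category.assoc, h₁, prod.lift_fst_assoc, s.condition]
      · rw [Category.assoc, h₂, prod.lift_snd_assoc, hc]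
    · intro s
      exact prod.lift_fst _ _
    · intro s m hm₁ hm₂
      have hc := (key s.fst s.snd s.condition).choose_spec
      apply Limits.prod.hom_ext
      · rw [prod.lift_fst]; exact hm₂
      · rw [prod.lift_snd]
        apply normalization_cancel
        rw [hc, ← hm₁, Category.assoc, Category.assoc, h₂]

variable (C) in
/-- The normalization functor `Nor : EqRel(C) ⥤ N(C)`. -/
def nor : EqRel C ⥤ NormalMono C :=
  ObjectProperty.lift _ norArrow (fun R =>
    ⟨R.rel, R.r₁, R.r₂, R.isEquivalenceRelation, isBournNormalTo_normalization R⟩)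

variable (C) in
/-- The functor `Nor`, corestricted to `N₀(C)`: the domain of a normalization has null support. -/
def nor₀ : EqRel C ⥤ NormalMono₀ C :=
  ObjectProperty.lift _ (nor C) (fun R => ⟨pullback.fst (initial.to R.base) R.r₁⟩)

end Nor

/-! ### The equivalence relation generated by an arrow -/

section Rel

variable [Regular C] [HasPushoutsOfSplitMono C]

instance hasPushout_diag {N X : C} (n : N ⟶ X) : HasPushout (diag N) n :=
  HasPushoutsOfSplitMono.hasPushout _ _ (IsSplitMono.mk' ⟨prod.fst, prod.lift_fst _ _⟩)

/-- The object of arrows of the reflexive graph `n_!(∇N)` on `X`, the pushout along `n : N ⟶ X`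
of the codiscrete graph `N × N ⇉ N`, taken along the diagonal `N ⟶ N × N`. -/
abbrev graph {N X : C} (n : N ⟶ X) : C := pushout (diag N) n

/-- The domain map of the reflexive graph `n_!(∇N)`; its unit map is `pushout.inr`. -/
def graphDom {N X : C} (n : N ⟶ X) : graph n ⟶ X :=
  pushout.desc (prod.fst ≫ n) (𝟙 X)
    (by rw [prod.lift_fst_assoc, Category.comp_id, Category.id_comp])

/-- The codomain map of the reflexive graph `n_!(∇N)`. -/
def graphCod {N X : C} (n : N ⟶ X) : graph n ⟶ X :=
  pushout.desc (prod.snd ≫ n) (𝟙 X)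
    (by rw [prod.lift_snd_assoc, Category.comp_id, Category.id_comp])

/-- The map `⟨dom, cod⟩ : n_!(∇N) ⟶ X × X`. -/
abbrev graphPair {N X : C} (n : N ⟶ X) : graph n ⟶ X ⨯ X :=
  prod.lift (graphDom n) (graphCod n)

/-- The underlying object of `Rel(n)`: the image of `⟨dom, cod⟩`, given by the (regular
epimorphism, monomorphism) factorization, i.e. the reflection of `n_!(∇N)` into reflexive
relations. -/
abbrev relObj {N X : C} (n : N ⟶ X) : C := image (graphPair n)

/-- `Rel(n)` is a reflexive relation. -/
def relReflexive {N X : C} (n : N ⟶ X) :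
    ReflexiveRelation (image.ι (graphPair n) ≫ prod.fst) (image.ι (graphPair n) ≫ prod.snd) where
  right_cancellation T a b h₁ h₂ := by
    rw [← cancel_mono (image.ι (graphPair n))]
    apply Limits.prod.hom_ext
    · simpa using h₁
    · simpa using h₂
  r := pushout.inr (diag N) n ≫ factorThruImage (graphPair n)
  reflexivity₁ := by
    rw [Category.assoc, image.fac_assoc, prod.lift_fst, graphDom, pushout.inr_desc]
  reflexivity₂ := by
    rw [Category.assoc, image.fac_assoc, prod.lift_snd, graphCod, pushout.inr_desc]

/-- The map induced on graphs by a morphism of arrows. -/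
def graphMap {n m : Arrow C} (f : n ⟶ m) : graph n.hom ⟶ graph m.hom :=
  pushout.desc (prod.map f.left f.left ≫ pushout.inl _ _) (f.right ≫ pushout.inr _ _) (by
    rw [← Arrow.w_assoc f, ← pushout.condition, ← Category.assoc, ← Category.assoc]
    congr 1
    apply Limits.prod.hom_ext <;> simp)

lemma graphMap_comm {n m : Arrow C} (f : n ⟶ m) :
    graphMap f ≫ graphPair m.hom = graphPair n.hom ≫ prod.map f.right f.right := by
  apply Limits.prod.hom_ext
  · rw [Category.assoc, Category.assoc, prod.map_fst, prod.lift_fst, prod.lift_fst_assoc]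
    apply pushout.hom_ext
    · rw [graphMap, graphDom, graphDom, pushout.inl_desc_assoc, pushout.inl_desc_assoc,
        Category.assoc, pushout.inl_desc, prod.map_fst_assoc, Category.assoc, Arrow.w]
    · rw [graphMap, graphDom, graphDom, pushout.inr_desc_assoc, pushout.inr_desc_assoc,
        Category.assoc, pushout.inr_desc, Category.comp_id, Category.id_comp]
  · rw [Category.assoc, Category.assoc, prod.map_snd, prod.lift_snd, prod.lift_snd_assoc]
    apply pushout.hom_ext
    · rw [graphMap, graphCod, graphCod, pushout.inl_desc_assoc, pushout.inl_desc_assoc,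
        Category.assoc, pushout.inl_desc, prod.map_snd_assoc, Category.assoc, Arrow.w]
    · rw [graphMap, graphCod, graphCod, pushout.inr_desc_assoc, pushout.inr_desc_assoc,
        Category.assoc, pushout.inr_desc, Category.comp_id, Category.id_comp]

/-- The map induced on the underlying objects of the relations by a morphism of arrows. -/
def relMap {n m : Arrow C} (f : n ⟶ m) : relObj n.hom ⟶ relObj m.hom :=
  image.map (Arrow.homMk (f := Arrow.mk (graphPair n.hom)) (g := Arrow.mk (graphPair m.hom))
    (graphMap f) (prod.map f.right f.right) (graphMap_comm f))

lemma relMap_ι {n m : Arrow C} (f : n ⟶ m) :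
    relMap f ≫ image.ι (graphPair m.hom) =
      image.ι (graphPair n.hom) ≫ prod.map f.right f.right :=
  image.map_ι _

variable [Maltsev C]

variable (C) in
/-- The functor `Rel` from arrows to equivalence relations, `Rel(n) = R(n_!(∇N))`; in a Mal'tsev
category this reflexive relation is an equivalence relation. -/
def relArrow : Arrow C ⥤ EqRel C where
  obj n :=
    { base := n.right
      rel := relObj n.hom
      r₁ := image.ι (graphPair n.hom) ≫ prod.fst
      r₂ := image.ι (graphPair n.hom) ≫ prod.snd
      isEquivalenceRelation :=
        Maltsev.isEquivalenceRelation_of_reflexive _ _ (relReflexive n.hom) }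
  map {n m} f :=
    { base := f.right
      rel := relMap f
      comm₁ := by
        rw [← Category.assoc, relMap_ι, Category.assoc, prod.map_fst, Category.assoc]
      comm₂ := by
        rw [← Category.assoc, relMap_ι, Category.assoc, prod.map_snd, Category.assoc] }
  map_id _ := EqRel.hom_ext rfl
  map_comp _ _ := EqRel.hom_ext rfl

variable (C) in
/-- The functor `Rel : N(C) ⥤ EqRel(C)`. -/
def rel : NormalMono C ⥤ EqRel C := ObjectProperty.ι _ ⋙ relArrow C

variable (C) in
/-- The restriction of `Rel` to `N₀(C)`. -/
def rel₀ [QuasiPointed C] : NormalMono₀ C ⥤ EqRel C := ObjectProperty.ι _ ⋙ rel C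

end Rel

end BournNormal

end

noncomputable section

namespace BournNormal

variable {C : Type u} [Category.{v} C]

/-! `Rel(n)` is the least equivalence relation on `X` that makes all elements of `N` equivalent
(`exists_lift_relObj`, `exists_relObj_lift`); the Mal'tsev condition serves only to make this image
an equivalence relation. Hence `Rel(Nor S)` lies inside `S`, which is the counit.

For the unit, `N` is compared with the class of `0` under `Rel(n)`. If `N` has null support, each of
its elements is related to `0`, so `N` is contained in that class
(`exists_left_normalization_relArrow`). Conversely, if `n` is normal to `R`, then `Rel(n)` is
contained in `R`; since `N` is saturated under `R` and contains `0`, it contains the class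
(`exists_normalization_relArrow_left`).

Unit and counit are identities on `X`. Morphisms in both categories are determined by their
component on `X`, because relations are jointly monic and normal arrows are monic. So naturality,
the triangle identities and invertibility reduce to identity laws on `X`. -/

lemma EqRel.exists_refl (R : EqRel C) {T : C} (f : T ⟶ R.base) :
    ∃ h : T ⟶ R.rel, h ≫ R.r₁ = f ∧ h ≫ R.r₂ = f := by
  obtain ⟨e⟩ := R.isEquivalenceRelation.nonempty_equivalenceRelation
  exact ⟨f ≫ e.r, by simp, by simp⟩

lemma EqRel.mono_of_base {R S : EqRel C} (f : R ⟶ S) [Mono f.base] : Mono f where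
  right_cancellation a b h := EqRel.hom_ext (by
    rw [← cancel_mono f.base, ← EqRel.comp_base, ← EqRel.comp_base, h])

lemma EqRel.mono_rel_of_base {R S : EqRel C} (f : R ⟶ S) [Mono f.base] : Mono f.rel where
  right_cancellation a b h := R.rel_ext
    (by rw [← cancel_mono f.base, Category.assoc, Category.assoc, ← f.comm₁, ← Category.assoc, h,
      Category.assoc])
    (by rw [← cancel_mono f.base, Category.assoc, Category.assoc, ← f.comm₂, ← Category.assoc, h,
      Category.assoc])

/-! ### Bourn-normal arrows: monicity and saturation -/

section Normal

variable [HasFiniteLimits C]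

lemma IsBournNormalTo.exists_lift {N X R : C} {n : N ⟶ X} {r₁ r₂ : R ⟶ X}
    (h : IsBournNormalTo n r₁ r₂) :
    ∃ t : N ⨯ N ⟶ R, t ≫ r₁ = prod.fst ≫ n ∧ t ≫ r₂ = prod.snd ≫ n := by
  obtain ⟨t, h₁, -⟩ := h
  have w := h₁.w
  rw [Category.id_comp] at w
  refine ⟨t, ?_, ?_⟩
  · simpa [prod.lift_fst] using congrArg (· ≫ prod.fst) w
  · simpa [prod.lift_snd] using congrArg (· ≫ prod.snd) w

/-- The equivalence class of an element of `N` lies in `N`. -/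
lemma IsBournNormalTo.exists_saturated {N X R T : C} {n : N ⟶ X} {r₁ r₂ : R ⟶ X}
    (h : IsBournNormalTo n r₁ r₂) (s : T ⟶ R) (a : T ⟶ N) (w : s ≫ r₁ = a ≫ n) :
    ∃ b : T ⟶ N, b ≫ n = s ≫ r₂ := by
  obtain ⟨t, h₁, h₂⟩ := h
  have w' : t ≫ r₂ = prod.snd ≫ n := by
    simpa [prod.lift_snd] using congrArg (· ≫ prod.snd) h₁.w
  -- The second pullback turns `s` into a pair `(a, b)` in `N × N`; its second entry is the witness.
  exact ⟨h₂.lift s a w ≫ prod.snd, by rw [Category.assoc, ← w', h₂.lift_fst_assoc]⟩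

lemma IsBournNormal.mono {N X : C} {n : N ⟶ X} (h : IsBournNormal n) : Mono n where
  right_cancellation {T} a b hab := by
    obtain ⟨R, r₁, r₂, hR, t, h₁, h₂⟩ := h
    have w₂ : t ≫ r₂ = prod.snd ≫ n := by
      simpa [prod.lift_snd] using congrArg (· ≫ prod.snd) h₁.w
    -- Both pairs have the same image in `R`, as `a` and `b` agree after `n`, and the same first
    -- projection; the second pullback separates pairs by these data.
    have key : prod.lift a a = prod.lift a b := by
      apply h₂.hom_ext
      · apply EqRel.rel_ext ⟨X, R, r₁, r₂, hR⟩
        · simp [h₂.w, prod.lift_fst_assoc]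
        · simp [w₂, hab, prod.lift_snd_assoc]
      · simp [prod.lift_fst]
    simpa [prod.lift_snd] using congrArg (· ≫ prod.snd) key

lemma NormalMono.hom_ext_right {n m : NormalMono C} {f g : n ⟶ m}
    (h : f.hom.right = g.hom.right) : f = g := by
  have := m.property.mono
  apply ObjectProperty.hom_ext
  apply Arrow.hom_ext _ _ _ h
  rw [← cancel_mono m.obj.hom]
  have e₁ := Arrow.w f.hom
  have e₂ := Arrow.w g.hom
  exact e₁.trans ((congrArg (n.obj.hom ≫ ·) h).trans e₂.symm)

lemma NormalMono₀.hom_ext_right [HasInitial C] {n m : NormalMono₀ C} {f g : n ⟶ m}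
    (h : f.hom.hom.right = g.hom.hom.right) : f = g :=
  ObjectProperty.hom_ext _ (NormalMono.hom_ext_right h)

/-- An element of `R` whose first component factors through `0` has its second component in the
normalization of `R`. -/
lemma exists_lift_normalization [HasInitial C] (R : EqRel C) {T : C} (z : T ⟶ ⊥_ C)
    (s : T ⟶ R.rel) (w : s ≫ R.r₁ = z ≫ initial.to R.base) :
    ∃ b : T ⟶ ker R.r₁, b ≫ normalization R = s ≫ R.r₂ :=
  ⟨pullback.lift z s w.symm, by rw [normalization, ← Category.assoc, pullback.lift_snd]⟩

end Normal

/-! ### Minimality of `Rel(n)` -/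

section Rel

variable [Regular C] [HasPushoutsOfSplitMono C]

/-- `Rel(n)` is contained in every equivalence relation which identifies all the elements of `N`;
stated relatively to a morphism of the bases. -/
lemma exists_relObj_lift {N X : C} (n : N ⟶ X) (S : EqRel C) (f : X ⟶ S.base)
    (t : N ⨯ N ⟶ S.rel) (ht₁ : t ≫ S.r₁ = prod.fst ≫ n ≫ f) (ht₂ : t ≫ S.r₂ = prod.snd ≫ n ≫ f) :
    ∃ l : relObj n ⟶ S.rel,
      l ≫ S.r₁ = (image.ι (graphPair n) ≫ prod.fst) ≫ f ∧
      l ≫ S.r₂ = (image.ι (graphPair n) ≫ prod.snd) ≫ f := by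
  -- Needed as an instance, so that the pullback projection `F.m` below is a monomorphism.
  have hS : Mono (prod.lift S.r₁ S.r₂) := ⟨fun a b h => S.rel_ext
    (by simpa [prod.lift_fst] using congrArg (· ≫ prod.fst) h) (by simpa [prod.lift_snd] using congrArg (· ≫ prod.snd) h)⟩
  obtain ⟨ρ, hρ₁, hρ₂⟩ := S.exists_refl f
  -- On `N × N` use the given `t`, on `X` the reflexivity of `S`; they agree on the diagonal of `N`.
  let g : graph n ⟶ S.rel := pushout.desc t ρ (by
    apply S.rel_ext
    · rw [Category.assoc, Category.assoc, ht₁, hρ₁, prod.lift_fst_assoc, Category.id_comp]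
    · rw [Category.assoc, Category.assoc, ht₂, hρ₂, prod.lift_snd_assoc, Category.id_comp])
  have hg₁ : g ≫ S.r₁ = graphDom n ≫ f := by
    apply pushout.hom_ext <;> simp [g, graphDom, ht₁, hρ₁, pushout.inl_desc_assoc, pushout.inr_desc_assoc]
  have hg₂ : g ≫ S.r₂ = graphCod n ≫ f := by
    apply pushout.hom_ext <;> simp [g, graphCod, ht₂, hρ₂, pushout.inl_desc_assoc, pushout.inr_desc_assoc]
  -- The inverse image of `S` along `f × f` is a subobject of `X × X` through which the graph
  -- factors, so it contains the image.
  let F : MonoFactorisation (graphPair n) :=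
    { I := pullback (prod.map f f) (prod.lift S.r₁ S.r₂)
      m := pullback.fst _ _
      e := pullback.lift (graphPair n) g (by
        apply Limits.prod.hom_ext <;> simp [hg₁, hg₂, prod.lift_fst, prod.lift_snd])
      fac := pullback.lift_fst _ _ _ }
  have hF : (image.lift F ≫ pullback.snd _ _) ≫ prod.lift S.r₁ S.r₂ =
      image.ι (graphPair n) ≫ prod.map f f := by
    rw [Category.assoc, ← pullback.condition, ← Category.assoc]
    exact congrArg (· ≫ prod.map f f) (image.lift_fac F)
  refine ⟨image.lift F ≫ pullback.snd _ _, ?_, ?_⟩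
  · simpa [prod.lift_fst] using congrArg (· ≫ prod.fst) hF
  · simpa [prod.lift_snd] using congrArg (· ≫ prod.snd) hF

/-- `Rel(n)` identifies all the elements of `N`. -/
lemma exists_lift_relObj {N X : C} (n : N ⟶ X) :
    ∃ t : N ⨯ N ⟶ relObj n,
      t ≫ image.ι (graphPair n) ≫ prod.fst = prod.fst ≫ n ∧
      t ≫ image.ι (graphPair n) ≫ prod.snd = prod.snd ≫ n :=
  ⟨pushout.inl _ _ ≫ factorThruImage (graphPair n),
    by rw [Category.assoc, image.fac_assoc, prod.lift_fst, graphDom, pushout.inl_desc],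
    by rw [Category.assoc, image.fac_assoc, prod.lift_snd, graphCod, pushout.inl_desc]⟩

/-! ### Unit, counit and the adjunctions -/

variable [Maltsev C] [QuasiPointed C]

lemma exists_left_normalization_relArrow (n : Arrow C) (hn : HasNullSupport n.left) :
    ∃ b : n.left ⟶ ker ((relArrow C).obj n).r₁,
      b ≫ normalization ((relArrow C).obj n) = n.hom := by
  obtain ⟨z⟩ := hn
  obtain ⟨t, ht₁, ht₂⟩ := exists_lift_relObj n.hom
  obtain ⟨b, hb⟩ := exists_lift_normalization ((relArrow C).obj n) z
    -- The pair `(0, x)` in `N × N`: null support supplies the element `0` of `N` over `N` itself.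
    (prod.lift (z ≫ initial.to n.left) (𝟙 _) ≫ t) (by
      refine (Category.assoc _ _ _).trans ?_
      refine (congrArg (_ ≫ ·) ht₁).trans ?_
      rw [prod.lift_fst_assoc, Category.assoc]
      congr 1
      exact initialIsInitial.hom_ext _ _)
  refine ⟨b, hb.trans ((Category.assoc _ _ _).trans ((congrArg (_ ≫ ·) ht₂).trans ?_))⟩
  rw [prod.lift_snd_assoc, Category.id_comp]

lemma exists_normalization_relArrow_left (n : Arrow C) (hn : IsBournNormal n.hom) :
    ∃ b : ker ((relArrow C).obj n).r₁ ⟶ n.left,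
      b ≫ n.hom = normalization ((relArrow C).obj n) := by
  obtain ⟨R, r₁, r₂, hR, h⟩ := hn
  obtain ⟨t, ht₁, ht₂⟩ := h.exists_lift
  obtain ⟨l, hl₁, hl₂⟩ := exists_relObj_lift n.hom ⟨n.right, R, r₁, r₂, hR⟩ (𝟙 _) t
    (by simpa using ht₁) (by simpa using ht₂)
  rw [Category.comp_id] at hl₁ hl₂
  -- Null support of `N` plays no role here: the kernel itself maps to the initial object, and from
  -- there to `N`.
  obtain ⟨b, hb⟩ := h.exists_saturated (kerι ((relArrow C).obj n).r₁ ≫ l)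
    (pullback.fst _ _ ≫ initial.to n.left) (by
      refine (Category.assoc _ _ _).trans ((congrArg (_ ≫ ·) hl₁).trans ?_)
      refine (pullback.condition (f := initial.to _) (g := ((relArrow C).obj n).r₁)).symm.trans ?_
      rw [Category.assoc]
      congr 1
      exact initialIsInitial.hom_ext _ _)
  exact ⟨b, hb.trans ((Category.assoc _ _ _).trans (congrArg (_ ≫ ·) hl₂))⟩

/-- A Bourn-normal monomorphism with null support is the normalization of the relation it
generates. -/
def normalMonoIso (n : NormalMono C) (hn : HasNullSupport n.obj.left) :
    n ≅ (nor C).obj ((rel C).obj n) where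
  hom := ObjectProperty.homMk
    (Arrow.homMk (exists_left_normalization_relArrow n.obj hn).choose (𝟙 n.obj.right)
      ((exists_left_normalization_relArrow n.obj hn).choose_spec.trans (Category.comp_id _).symm))
  inv := ObjectProperty.homMk
    (Arrow.homMk (exists_normalization_relArrow_left n.obj n.property).choose (𝟙 n.obj.right)
      ((exists_normalization_relArrow_left n.obj n.property).choose_spec.trans
        (Category.comp_id _).symm))
  hom_inv_id := NormalMono.hom_ext_right (Category.comp_id _)
  inv_hom_id := NormalMono.hom_ext_right (Category.comp_id _)

lemma essImage_nor_iff (n : NormalMono C) :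
    (nor C).essImage n ↔ HasNullSupport n.obj.left := by
  constructor
  · rintro ⟨R, ⟨e⟩⟩
    exact ⟨e.inv.hom.left ≫ pullback.fst (initial.to R.base) R.r₁⟩
  · exact fun hn => ⟨_, ⟨(normalMonoIso n hn).symm⟩⟩

variable (C) in
/-- The unit of the adjunction `Rel ⊣ Nor`. -/
def unitIso : 𝟭 (NormalMono₀ C) ≅ rel₀ C ⋙ nor₀ C :=
  NatIso.ofComponents (fun n => ObjectProperty.isoMk _ (normalMonoIso n.obj n.property))
    (fun _ => NormalMono₀.hom_ext_right ((Category.comp_id _).trans (Category.id_comp _).symm))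

lemma exists_counit (S : EqRel C) :
    ∃ f : (rel₀ C).obj ((nor₀ C).obj S) ⟶ S, f.base = 𝟙 S.base := by
  obtain ⟨t, ht₁, ht₂⟩ := (isBournNormalTo_normalization S).exists_lift
  obtain ⟨l, hl₁, hl₂⟩ := exists_relObj_lift (normalization S) S (𝟙 _) t
    (by rw [Category.comp_id, ht₁]) (by rw [Category.comp_id, ht₂])
  exact ⟨⟨𝟙 _, l, hl₁, hl₂⟩, rfl⟩

variable (C) in
/-- The counit of the adjunction `Rel ⊣ Nor`. -/
def counit : nor₀ C ⋙ rel₀ C ⟶ 𝟭 (EqRel C) where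
  app S := (exists_counit S).choose
  naturality S T f := EqRel.hom_ext (by
    have hS := (exists_counit S).choose_spec
    have hT := (exists_counit T).choose_spec
    refine (congrArg (f.base ≫ ·) hT).trans (.trans ?_ (congrArg (· ≫ f.base) hS.symm))
    exact (Category.comp_id f.base).trans (Category.id_comp f.base).symm)

lemma counit_app_base (S : EqRel C) : ((counit C).app S).base = 𝟙 S.base :=
  (exists_counit S).choose_spec

variable (C) in
/-- The coreflection `Rel ⊣ Nor` between Bourn-normal monomorphisms whose domain has null support
and equivalence relations. -/
def relNorAdj : rel₀ C ⊣ nor₀ C where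
  unit := (unitIso C).hom
  counit := counit C
  left_triangle_components n := EqRel.hom_ext
    ((Category.id_comp _).trans (counit_app_base ((rel₀ C).obj n)))
  right_triangle_components S := NormalMono₀.hom_ext_right
    ((Category.id_comp _).trans (counit_app_base S))

variable (C) in
/-- The restriction of the adjunction `Rel ⊣ Nor` to the essential image of `Rel`. -/
def relNorAdjEssImage : (rel₀ C).toEssImage ⊣ (rel₀ C).essImage.ι ⋙ nor₀ C where
  unit := { app n := (relNorAdj C).unit.app n
            naturality _ _ f := (relNorAdj C).unit.naturality f }
  counit :=
    { app S := ObjectProperty.homMk ((relNorAdj C).counit.app S.obj)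
      naturality _ _ f := ObjectProperty.hom_ext _ ((relNorAdj C).counit.naturality f.hom) }
  left_triangle_components n :=
    ObjectProperty.hom_ext _ ((relNorAdj C).left_triangle_components n)
  right_triangle_components S := (relNorAdj C).right_triangle_components S.obj

end Rel

end BournNormal

end

theorem mainTheorem1 {C : Type u} [Category.{v} C] [Regular C] [BournNormal.QuasiPointed C]
    [BournNormal.Maltsev C] [BournNormal.HasPushoutsOfSplitMono C] :
    (∀ n : BournNormal.NormalMono C,
      (BournNormal.nor C).essImage n ↔ BournNormal.HasNullSupport n.obj.left) ∧
    ∃ adj : BournNormal.rel₀ C ⊣ BournNormal.nor₀ C,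
      ((BournNormal.rel₀ C).Full ∧ (BournNormal.rel₀ C).Faithful ∧ IsIso adj.unit ∧
        (∀ n, (adj.unit.app n).hom.hom.right = 𝟙 n.obj.obj.right) ∧
        (∀ S, (adj.counit.app S).base = 𝟙 S.base) ∧
        (∀ S, Mono (adj.counit.app S)) ∧
        (∀ S, Mono (adj.counit.app S).rel)) ∧
      ∃ adj' : (BournNormal.rel₀ C).toEssImage ⊣
          (BournNormal.rel₀ C).essImage.ι ⋙ BournNormal.nor₀ C,
        IsIso adj'.unit ∧ IsIso adj'.counit ∧
        (∀ n, adj'.unit.app n = adj.unit.app n) ∧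
        (∀ S, (adj'.counit.app S).hom = adj.counit.app S.obj) := by
  have hu : IsIso (BournNormal.relNorAdj C).unit :=
    inferInstanceAs (IsIso (BournNormal.unitIso C).hom)
  have ff := (BournNormal.relNorAdj C).fullyFaithfulLOfIsIsoUnit
  have hFull := ff.full
  have hFaithful := ff.faithful
  have hbase (S : BournNormal.EqRel C) : Mono ((BournNormal.relNorAdj C).counit.app S).base := by
    rw [show ((BournNormal.relNorAdj C).counit.app S).base = 𝟙 S.base from
      BournNormal.counit_app_base S]
    exact inferInstanceAs (Mono (𝟙 S.base))
  refine ⟨BournNormal.essImage_nor_iff, BournNormal.relNorAdj C,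
    ⟨hFull, hFaithful, hu, fun _ => rfl, BournNormal.counit_app_base,
      fun S => BournNormal.EqRel.mono_of_base _, fun S => BournNormal.EqRel.mono_rel_of_base _⟩,
    BournNormal.relNorAdjEssImage C, ?_, ?_, fun _ => rfl, fun _ => rfl⟩
  · have (n : BournNormal.NormalMono₀ C) :
        IsIso ((BournNormal.relNorAdjEssImage C).unit.app n) :=
      inferInstanceAs (IsIso ((BournNormal.relNorAdj C).unit.app n))
    exact NatIso.isIso_of_isIso_app _
  · have (S : (BournNormal.rel₀ C).EssImageSubcategory) :
        IsIso ((BournNormal.relNorAdjEssImage C).counit.app S) := by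
      rw [← ObjectProperty.isIso_hom_iff]
      obtain ⟨n, ⟨e⟩⟩ := S.property
      -- At an object `Rel(n)`, the triangle identity makes the counit inverse to the image of the
      -- invertible unit; this transfers along `e`.
      exact (BournNormal.relNorAdj C).isIso_counit_app_of_iso e.symm
    exact NatIso.isIso_of_isIso_app _
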